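/- Setting. Let $G$ be a finite directed acyclic graph whose nodes are discrete (finite-state) variables, with set of observed variables $\mathbf V$; the other variables are hidden. $G$ is assumed semi-Markovian: every hidden variable is a root of $G$ and has exactly two children. A model of $G$ consists of parameters $\theta_{x\mid \mathbf p}\ge 0$ for every variable $X$, state $x$ of $X$ and instantiation $\mathbf p$ of the parents $\mathbf P_X$ of $X$ in $G$, with $\sum_x\theta_{x\mid\mathbf p}=1$; it induces the distribution $\Pr=\prod_X\theta_{X\mid\mathbf P_X}$. Let $\mathcal M[\Pr(\mathbf V)>0]$ be the set of models with $\Pr(\mathbf v)>0$ for every instantiation $\mathbf v$ of $\mathbf V$. Subgraphs are induced subgraphs, given by their node sets. A c-component of a subgraph $T$ is a nonempty subgraph $C$ of $T$ in which all variables are connected by bidirected paths, i.e. paths composed of pieces $X\leftarrow U\rightarrow Y$ with $U$ hidden (a hidden variable of $C$ being joined to its children in $C$); it is maximal if it is contained in no larger c-component of $T$. A subgraph $S$ of $G$ is $\mathbf V$-computable if (1) $S=G$, or (2) $S$ is a maximal c-component of a $\mathbf V$-computable subgraph, or (3) $S$ is obtained from a $\mathbf V$-computable subgraph $T$ by deleting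 a leaf of $T$ (a node of $T$ without children in $T$). The c-factor of $S$ is the expression $$Q[S]=\sum_{\mathbf U_S}\ \prod_{U\in\mathbf U_S}\theta_U\ \prod_{X\in\mathbf V_S}\theta_{X\mid\mathbf P_X},$$ where $\mathbf U_S$ and $\mathbf V_S$ are the hidden and the observed variables in $S$. An expression is built from real constants, parameters $\theta_{X\mid\mathbf P_X}$ and conditional probabilities $\Pr(\mathbf A\mid\mathbf B)$ by addition, multiplication, division, summation over the states of variables, and setting a variable to a state. Two expressions are $\langle G,\mathbf V,\mathcal M\rangle$-equivalent if, under every model in $\mathcal M$ and at every instantiation of the variables, both are defined (no division by zero and no conditioning on an event of probability zero) and have the same value. A $\langle G,\mathbf V,\mathcal M\rangle$-projection of an expression $\mathcal E$ is an expression equivalent to $\mathcal E$ that contains no parameters and mentions no hidden variables. Corollary. If $S$ is a $\mathbf V$-computable subgraph of $G$, then $Q[S]$ has a $\langle G,\mathbf V,\mathcal M[\Pr(\mathbf V)>0]\rangle$-projection. -/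

import Mathlib

namespace CausalID

/-- A causal graph: a directed acyclic graph on the set `N` of (observed and hidden) variables. -/
structure CausalGraph (N : Type*) extends Digraph N where
  acyclic : ∀ n, ¬ Relation.TransGen Adj n n

namespace CausalGraph

variable {N : Type*} (G : CausalGraph N)

/-- Given the set `V` of observed variables, the graph is semi-Markovian: every hidden variable
is a root and has exactly two children. -/
def SemiMarkovian (V : Finset N) : Prop :=
  ∀ u ∉ V, (∀ m, ¬ G.Adj m u) ∧ {m | G.Adj u m}.ncard = 2

/-- One edge `U → X` with `U` hidden, traversed in either direction inside the node set `C`.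
Chains of such steps between observed variables are exactly the bidirected paths
`X ← U → Y ← U' → Z …` inside `C`. -/
def BidirectedStep (V C : Finset N) (a b : N) : Prop :=
  a ∈ C ∧ b ∈ C ∧ ((a ∉ V ∧ G.Adj a b) ∨ (b ∉ V ∧ G.Adj b a))

/-- Subgraphs are induced and identified with their node sets. `C` is a c-component of the
subgraph `T`: a nonempty subgraph of `T` whose variables are all connected by bidirected paths
inside `C`. -/
def IsCComponent (V T C : Finset N) : Prop :=
  C.Nonempty ∧ C ⊆ T ∧ ∀ a ∈ C, ∀ b ∈ C, Relation.ReflTransGen (G.BidirectedStep V C) a b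

/-- `C` is a maximal c-component of the subgraph `T`. -/
def IsMaximalCComponent (V T C : Finset N) : Prop :=
  Maximal (G.IsCComponent V T) C

/-- `w` is a leaf of the subgraph `T`: it has no child in `T`. -/
def IsLeafOf (T : Finset N) (w : N) : Prop :=
  w ∈ T ∧ ∀ m ∈ T, ¬ G.Adj w m

/-- The `V`-computable subgraphs of `G`. -/
inductive VComputable [Fintype N] [DecidableEq N] (V : Finset N) : Finset N → Prop
  | whole : VComputable V Finset.univ
  | component {T S : Finset N} :
      VComputable V T → G.IsMaximalCComponent V T S → VComputable V S
  | prune {T : Finset N} {w : N} :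
      VComputable V T → G.IsLeafOf T w → VComputable V (T.erase w)

end CausalGraph

/-- A model: a full parametrization of `G`, where variable `n` has the states `σ n`. It consists of
the parameters `θ_{x|p}`, for each state `x` of each variable `n` and each instantiation `p` of
the parents of `n`. -/
structure Model {N : Type*} (G : CausalGraph N) (σ : N → Type*) [∀ n, Fintype (σ n)] where
  θ : ∀ n, σ n → (∀ m : {m // G.Adj m n}, σ m) → ℝ
  nonneg : ∀ n x p, 0 ≤ θ n x p
  sum_eq_one : ∀ n p, ∑ x, θ n x p = 1

/-- Expressions, in which a variable stands for its current state.
* `param n` is the parameter `θ_{n | P_n}`, where `P_n` are the parents of `n`;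
* `condProb A B` is the conditional probability `Pr(A | B)` (so `Pr(A)` for `B = ∅`);
* `sum W e` is `∑_W e`, the sum over all instantiations of the variables `W`;
* `fix n x e` is `e` with the variable `n` set to the state `x`. -/
inductive Expr (N : Type*) (σ : N → Type*) where
  | const : ℝ → Expr N σ
  | param : N → Expr N σ
  | condProb : Finset N → Finset N → Expr N σ
  | add : Expr N σ → Expr N σ → Expr N σ
  | mul : Expr N σ → Expr N σ → Expr N σ
  | div : Expr N σ → Expr N σ → Expr N σ
  | sum : Finset N → Expr N σ → Expr N σ
  | fix : (n : N) → σ n → Expr N σ → Expr N σ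

section Semantics

variable {N : Type*} [Fintype N] [DecidableEq N] {σ : N → Type*} [∀ n, Fintype (σ n)]
  [∀ n, DecidableEq (σ n)] {G : CausalGraph N}

namespace Model

/-- The joint distribution `Pr(ω) = ∏ₙ θ_{n | P_n}` of all variables. -/
def joint (M : Model G σ) (ω : ∀ n, σ n) : ℝ :=
  ∏ n, M.θ n (ω n) (fun m => ω m)

/-- The marginal probability `Pr(A = v_A)`. -/
def prob (M : Model G σ) (A : Finset N) (v : ∀ n, σ n) : ℝ :=
  ∑ ω : ∀ n, σ n with ∀ n ∈ A, ω n = v n, M.joint ω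

end Model

/-- `𝓜[Pr(V) > 0]`: the models of `G` with a strictly positive observational distribution. -/
def positiveModels (G : CausalGraph N) (σ : N → Type*) [∀ n, Fintype (σ n)]
    [∀ n, DecidableEq (σ n)] (V : Finset N) : Set (Model G σ) :=
  {M | ∀ v, 0 < M.prob V v}

namespace Expr

/-- The value of an expression under a model, at an instantiation `v` of the variables. -/
noncomputable def eval (M : Model G σ) : Expr N σ → (∀ n, σ n) → ℝ
  | const c, _ => c
  | param n, v => M.θ n (v n) (fun m => v m)
  | condProb A B, v => M.prob (A ∪ B) v / M.prob B v
  | add e₁ e₂, v => eval M e₁ v + eval M e₂ v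
  | mul e₁ e₂, v => eval M e₁ v * eval M e₂ v
  | div e₁ e₂, v => eval M e₁ v / eval M e₂ v
  | sum W e, v => ∑ ω : ∀ n, σ n with ∀ n ∉ W, ω n = v n, eval M e ω
  | fix n x e, v => eval M e (Function.update v n x)

/-- The value of the expression is defined: no division by zero and no conditioning on an event
of probability zero occurs. -/
def IsDefined (M : Model G σ) : Expr N σ → (∀ n, σ n) → Prop
  | const _, _ => True
  | param _, _ => True
  | condProb _ B, v => M.prob B v ≠ 0
  | add e₁ e₂, v => IsDefined M e₁ v ∧ IsDefined M e₂ v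
  | mul e₁ e₂, v => IsDefined M e₁ v ∧ IsDefined M e₂ v
  | div e₁ e₂, v => IsDefined M e₁ v ∧ IsDefined M e₂ v ∧ eval M e₂ v ≠ 0
  | sum W e, v => ∀ ω : ∀ n, σ n, (∀ n ∉ W, ω n = v n) → IsDefined M e ω
  | fix n x e, v => IsDefined M e (Function.update v n x)

/-- The expression contains no parameters `θ`. -/
def ParamFree : Expr N σ → Prop
  | const _ => True
  | param _ => False
  | condProb _ _ => True
  | add e₁ e₂ => ParamFree e₁ ∧ ParamFree e₂
  | mul e₁ e₂ => ParamFree e₁ ∧ ParamFree e₂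
  | div e₁ e₂ => ParamFree e₁ ∧ ParamFree e₂
  | sum _ e => ParamFree e
  | fix _ _ e => ParamFree e

/-- The variables mentioned (free or bound) in an expression. -/
def mentions (G : CausalGraph N) : Expr N σ → Set N
  | const _ => ∅
  | param n => {n} ∪ {m | G.Adj m n}
  | condProb A B => ↑A ∪ ↑B
  | add e₁ e₂ => mentions G e₁ ∪ mentions G e₂
  | mul e₁ e₂ => mentions G e₁ ∪ mentions G e₂
  | div e₁ e₂ => mentions G e₁ ∪ mentions G e₂
  | sum W e => ↑W ∪ mentions G e
  | fix n _ e => {n} ∪ mentions G e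

/-- Two expressions are equivalent with respect to a set of models: they have the same (defined)
value under all these models, at every instantiation of the variables. -/
def Equivalent (𝓜 : Set (Model G σ)) (e₁ e₂ : Expr N σ) : Prop :=
  ∀ M ∈ 𝓜, ∀ v, e₁.IsDefined M v ∧ e₂.IsDefined M v ∧ e₁.eval M v = e₂.eval M v

/-- `e₁` is a `⟨G, V, 𝓜⟩`-projection of `e₂`: it is equivalent to `e₂`, contains no parameters and
mentions no hidden variables. -/
def IsProjection (G : CausalGraph N) (V : Finset N) (𝓜 : Set (Model G σ))
    (e₁ e₂ : Expr N σ) : Prop :=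
  Equivalent 𝓜 e₁ e₂ ∧ e₁.ParamFree ∧ e₁.mentions G ⊆ ↑V

/-- The product of a list of expressions. -/
def listProd (l : List (Expr N σ)) : Expr N σ :=
  l.foldr mul (const 1)

/-- The c-factor `Q[S] = ∑_U ∏_{U} θ_U ∏_{X} θ_{X | P_X}`, where `U` and `X` range over the hidden
and the observed variables of the subgraph `S`. Parents are taken in the whole graph. -/
noncomputable def cFactor (σ : N → Type*) (V S : Finset N) : Expr N σ :=
  sum (S \ V) (mul (listProd ((S \ V).toList.map param)) (listProd ((S ∩ V).toList.map param)))

end Expr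

end Semantics

end CausalID

/-!
The c-factor `Q[S]` is, under a model, the sum over the hidden variables of `S` of the product of
the parameters of all variables of `S`. Three facts about these sums suffice.

* `Q[G] = Pr(V)`, which is positive by assumption.
* If `w` is a leaf of `T`, then `θ_{w | P_w}` is the only factor of `Q[T]` that depends on `w`, and
  it sums to one (`marginal_factors_of_leaf`). So `Q[T ∖ w]` is `∑_w Q[T]` when `w` is observed, and
  `Q[T]` itself when `w` is hidden.
* If `S` is a union of maximal c-components of `T`, then no hidden variable of `T` occurs in
  parameters both of `S` and of `T ∖ S`, and hence `Q[T] = Q[S] Q[T ∖ S]` (`qValue_eq_mul_sdiff`).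

The step from `T` to a maximal c-component is made for all unions `S` of maximal c-components at
once, by induction on the size of `T` (`Identified.of_isCClosed`). Let `w` be a leaf of `T`. If
`w ∉ S`, then `S` is a union of components of `T ∖ w`. If `w ∈ S`, then `S ∖ w` is one, and dividing
`Q[T] = Q[S] Q[T ∖ S]` by `Q[T ∖ w] = Q[S ∖ w] Q[T ∖ S]` gives `Q[S] = Q[S ∖ w] Q[T] / Q[T ∖ w]`.
The division is legitimate because all these c-factors are positive, so positivity is carried
through the induction along with the projection.
-/

namespace CausalID

/-! ### Leaves and c-components -/

namespace CausalGraph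

variable {N : Type*} (G : CausalGraph N)

theorem exists_isLeafOf [Finite N] {T : Finset N} (hT : T.Nonempty) : ∃ w, G.IsLeafOf T w := by
  let r : N → N → Prop := fun a b => Relation.TransGen G.Adj b a
  have : IsTrans N r := ⟨fun a b c hab hbc => Relation.TransGen.trans hbc hab⟩
  have : Std.Irrefl r := ⟨fun a => G.acyclic a⟩
  obtain ⟨w, hw, hmin⟩ := (Finite.wellFounded_of_trans_of_irrefl r).has_min (T : Set N) hT
  exact ⟨w, hw, fun m hm h => hmin m hm (Relation.TransGen.single h)⟩

/-- `T` contains all hidden parents of its members. This makes the c-factor of `T` a function of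
the observed variables only. -/
def HiddenParentClosed (V T : Finset N) : Prop :=
  ∀ u ∉ V, ∀ x ∈ T, G.Adj u x → u ∈ T

/-- `S` is a union of maximal c-components of `T`, that is, no edge of `T` that leaves a hidden
variable joins `S` to `T ∖ S`. -/
def IsCClosed (V T S : Finset N) : Prop :=
  S ⊆ T ∧ ∀ u ∈ T, u ∉ V → ∀ x ∈ T, G.Adj u x → (u ∈ S ↔ x ∈ S)

variable {G} {V T S : Finset N}

theorem BidirectedStep.symm {a b : N} (h : G.BidirectedStep V T a b) :
    G.BidirectedStep V T b a :=
  ⟨h.2.1, h.1, h.2.2.symm⟩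

theorem BidirectedStep.mono (hST : S ⊆ T) {a b : N} (h : G.BidirectedStep V S a b) :
    G.BidirectedStep V T a b :=
  ⟨hST h.1, hST h.2.1, h.2.2⟩

theorem IsCClosed.hiddenParentClosed (hS : G.IsCClosed V T S) (hT : G.HiddenParentClosed V T) :
    G.HiddenParentClosed V S := fun u huV x hx hux =>
  (hS.2 u (hT u huV x (hS.1 hx) hux) huV x (hS.1 hx) hux).2 hx

variable [DecidableEq N]

theorem IsCComponent.insert (hS : G.IsCComponent V T S) {a x : N} (ha : a ∈ S) (hx : x ∈ T)
    (h : G.BidirectedStep V (insert x S) a x) : G.IsCComponent V T (insert x S) := by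
  refine ⟨Finset.insert_nonempty _ _, Finset.insert_subset hx hS.2.1, ?_⟩
  have inner : ∀ b ∈ S, ∀ c ∈ S,
      Relation.ReflTransGen (G.BidirectedStep V (Insert.insert x S)) b c := fun b hb c hc =>
    Relation.ReflTransGen.mono (fun _ _ => BidirectedStep.mono (Finset.subset_insert x S))
      _ _ (hS.2.2 b hb c hc)
  intro b hb c hc
  rcases Finset.mem_insert.1 hb with hbx | hb <;> rcases Finset.mem_insert.1 hc with hcx | hc
  · rw [hbx, hcx]
  · rw [hbx]
    exact (inner a ha c hc).head h.symm
  · rw [hcx]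
    exact (inner b hb a ha).tail h
  · exact inner b hb c hc

theorem IsMaximalCComponent.mem_of_step (hS : G.IsMaximalCComponent V T S) {a x : N}
    (ha : a ∈ S) (hx : x ∈ T) (h : G.BidirectedStep V (insert x S) a x) : x ∈ S :=
  hS.2 (hS.1.insert ha hx h) (Finset.subset_insert x S) (Finset.mem_insert_self x S)

theorem IsMaximalCComponent.isCClosed (hS : G.IsMaximalCComponent V T S) :
    G.IsCClosed V T S := by
  refine ⟨hS.1.2.1, fun u hu huV x hx hux => ⟨fun huS => ?_, fun hxS => ?_⟩⟩
  · exact hS.mem_of_step huS hx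
      ⟨Finset.mem_insert_of_mem huS, Finset.mem_insert_self _ _, Or.inl ⟨huV, hux⟩⟩
  · exact hS.mem_of_step hxS hu
      ⟨Finset.mem_insert_of_mem hxS, Finset.mem_insert_self _ _, Or.inr ⟨huV, hux⟩⟩

theorem IsCClosed.sdiff (hS : G.IsCClosed V T S) : G.IsCClosed V T (T \ S) := by
  refine ⟨Finset.sdiff_subset, fun u hu huV x hx hux => ?_⟩
  simp [hu, hx, hS.2 u hu huV x hx hux]

theorem HiddenParentClosed.erase (hT : G.HiddenParentClosed V T) {w : N}
    (hw : G.IsLeafOf T w) : G.HiddenParentClosed V (T.erase w) := by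
  intro u huV x hx hux
  have hxT := Finset.mem_of_mem_erase hx
  refine Finset.mem_erase.2 ⟨?_, hT u huV x hxT hux⟩
  rintro rfl
  exact hw.2 x hxT hux

theorem IsCClosed.erase (hS : G.IsCClosed V T S) (w : N) :
    G.IsCClosed V (T.erase w) (S.erase w) := by
  refine ⟨Finset.erase_subset_erase w hS.1, fun u hu huV x hx hux => ?_⟩
  rw [Finset.mem_erase] at hu hx
  simp [hu.1, hx.1, hS.2 u hu.2 huV x hx.2 hux]

end CausalGraph

section Semantics

variable {N : Type*} [Fintype N] [DecidableEq N] {σ : N → Type*} [∀ n, Fintype (σ n)]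
  [∀ n, DecidableEq (σ n)] {G : CausalGraph N}

/-! ### Summing out variables -/

/-- `∑_H f`: the sum of `f` over all instantiations of the variables `H`, the other variables
keeping the states that they have in `v`. -/
def marginal (H : Finset N) (f : (∀ n, σ n) → ℝ) (v : ∀ n, σ n) : ℝ :=
  ∑ ω : ∀ n, σ n with ∀ n ∉ H, ω n = v n, f ω

/-- The value of `f` does not depend on the states of the variables `H`. -/
def IndependentOf (H : Finset N) (f : (∀ n, σ n) → ℝ) : Prop :=
  ∀ ω v, (∀ n ∉ H, ω n = v n) → f ω = f v

theorem marginal_empty (f : (∀ n, σ n) → ℝ) (v : ∀ n, σ n) : marginal ∅ f v = f v := by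
  have : (Finset.univ.filter fun ω : ∀ n, σ n => ∀ n ∉ (∅ : Finset N), ω n = v n) = {v} := by
    ext ω
    simp [funext_iff]
  rw [marginal, this, Finset.sum_singleton]

theorem marginal_singleton (w : N) (f : (∀ n, σ n) → ℝ) (v : ∀ n, σ n) :
    marginal {w} f v = ∑ x, f (Function.update v w x) := by
  refine Finset.sum_nbij' (fun ω => ω w) (fun x => Function.update v w x) ?_ ?_ ?_ ?_ ?_
  · simp
  · intro x _
    simp +contextual
  · intro ω hω
    ext n
    by_cases h : n = w
    · subst h; simp
    · simp_all
  · simp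
  · intro ω hω
    congr 1
    ext n
    by_cases h : n = w
    · subst h; simp
    · simp_all

theorem marginal_union {H K : Finset N} (hHK : Disjoint H K) (f : (∀ n, σ n) → ℝ)
    (v : ∀ n, σ n) : marginal (H ∪ K) f v = marginal H (marginal K f) v := by
  unfold marginal
  -- After exchanging the sums, `ω'` determines `ω`: it agrees with `v` on `K`, with `ω'` elsewhere.
  rw [Finset.sum_comm' (t' := Finset.univ.filter fun ω' : ∀ n, σ n => ∀ n ∉ H ∪ K, ω' n = v n)
    (s' := fun ω' => {fun n => if n ∈ K then v n else ω' n})]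
  · simp
  · intro ω ω'
    simp only [Finset.mem_filter, Finset.mem_univ, true_and, Finset.mem_singleton,
      Finset.mem_union, not_or]
    constructor
    · rintro ⟨h1, h2⟩
      refine ⟨funext fun n => ?_, fun n hn => (h2 n hn.2).trans (h1 n hn.1)⟩
      split_ifs with hn
      · exact h1 n (Finset.disjoint_right.1 hHK hn)
      · exact (h2 n hn).symm
    · rintro ⟨rfl, h⟩
      refine ⟨fun n hn => ?_, fun n hn => by simp [hn]⟩
      by_cases hK : n ∈ K <;> simp [hK, h n, hn]

theorem marginal_mul_of_independentOf {H : Finset N} {f : (∀ n, σ n) → ℝ}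
    (hf : IndependentOf H f) (g : (∀ n, σ n) → ℝ) (v : ∀ n, σ n) :
    marginal H (fun ω => f ω * g ω) v = f v * marginal H g v := by
  rw [marginal, marginal, Finset.mul_sum]
  refine Finset.sum_congr rfl fun ω hω => ?_
  rw [hf ω v (Finset.mem_filter.1 hω).2]

theorem IndependentOf.marginal {H : Finset N} {g : (∀ n, σ n) → ℝ} (hg : IndependentOf H g)
    (K : Finset N) : IndependentOf H (marginal K g) := by
  intro ω v h
  -- Overwriting the states outside `K` matches the two index sets.
  refine Finset.sum_nbij' (fun x n => if n ∈ K then x n else v n)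
    (fun x n => if n ∈ K then x n else ω n) ?_ ?_ ?_ ?_ ?_
  · intro x _
    simp +contextual
  · intro x _
    simp +contextual
  · intro x hx
    ext n
    by_cases hn : n ∈ K <;> simp_all
  · intro x hx
    ext n
    by_cases hn : n ∈ K <;> simp_all
  · intro x hx
    refine hg _ _ fun n hn => ?_
    by_cases hK : n ∈ K <;> simp_all

theorem marginal_mul_mul {H K : Finset N} (hHK : Disjoint H K) {f g : (∀ n, σ n) → ℝ}
    (hf : IndependentOf K f) (hg : IndependentOf H g) (v : ∀ n, σ n) :
    marginal (H ∪ K) (fun ω => f ω * g ω) v = marginal H f v * marginal K g v := by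
  rw [marginal_union hHK, funext fun ω => marginal_mul_of_independentOf hf g ω]
  simp_rw [mul_comm (f _)]
  rw [marginal_mul_of_independentOf (hg.marginal K), mul_comm]

/-! ### Values of c-factors -/

namespace Model

/-- The parameter `θ_{n | P_n}` at the states given by `ω`. -/
def factor (M : Model G σ) (n : N) (ω : ∀ n, σ n) : ℝ :=
  M.θ n (ω n) (fun m => ω m)

/-- The product of the parameters of the variables in `T`. -/
def factors (M : Model G σ) (T : Finset N) (ω : ∀ n, σ n) : ℝ :=
  ∏ n ∈ T, M.factor n ω

/-- The value of the c-factor `Q[T]`. -/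
def qValue (M : Model G σ) (V T : Finset N) (v : ∀ n, σ n) : ℝ :=
  marginal (T \ V) (M.factors T) v

variable (M : Model G σ) {V T S : Finset N}

theorem independentOf_factors {H : Finset N} (hT : Disjoint T H)
    (hpa : ∀ n ∈ T, ∀ m, G.Adj m n → m ∉ H) : IndependentOf H (M.factors T) := by
  intro ω v h
  refine Finset.prod_congr rfl fun n hn => ?_
  have hp : (fun m : {m // G.Adj m n} => ω m) = fun m : {m // G.Adj m n} => v m :=
    funext fun m => h m (hpa n hn m m.2)
  rw [factor, factor, h n (Finset.disjoint_left.1 hT hn), hp]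

theorem marginal_factor_self (w : N) (v : ∀ n, σ n) : marginal {w} (M.factor w) v = 1 := by
  rw [marginal_singleton, ← M.sum_eq_one w (fun m => v m)]
  refine Finset.sum_congr rfl fun x _ => ?_
  have hp : (fun m : {m // G.Adj m w} => Function.update v w x m) =
      fun m : {m // G.Adj m w} => v m := by
    funext m
    refine Function.update_of_ne (fun h => ?_) _ _
    have hm := m.2
    rw [h] at hm
    exact G.acyclic w (Relation.TransGen.single hm)
  rw [factor, hp, Function.update_self]

/-- Summing out a leaf of `T` removes its parameter and nothing else. -/
theorem marginal_factors_of_leaf {H : Finset N} {w : N} (hw : G.IsLeafOf T w) (hwH : w ∈ H)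
    (v : ∀ n, σ n) :
    marginal H (M.factors T) v = marginal (H.erase w) (M.factors (T.erase w)) v := by
  have hH : H = H.erase w ∪ {w} := by
    rw [Finset.union_comm, ← Finset.insert_eq, Finset.insert_erase hwH]
  have hind : IndependentOf {w} (M.factors (T.erase w)) := by
    refine M.independentOf_factors (by simp) fun n hn m hm hmw => ?_
    rw [Finset.mem_singleton.1 hmw] at hm
    exact hw.2 n (Finset.mem_of_mem_erase hn) hm
  have hprod : M.factors T = fun ω => M.factors (T.erase w) ω * M.factor w ω :=
    funext fun ω => (Finset.prod_erase_mul T _ hw.1).symm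
  conv_lhs => rw [hH]
  rw [marginal_union (by simp), hprod]
  congr 1
  funext ω
  rw [marginal_mul_of_independentOf hind, M.marginal_factor_self, mul_one]

theorem marginal_factors_self (T : Finset N) (v : ∀ n, σ n) :
    marginal T (M.factors T) v = 1 := by
  induction hk : T.card generalizing T with
  | zero =>
    rw [Finset.card_eq_zero.1 hk, marginal_empty]
    simp [factors]
  | succ k ih =>
    obtain ⟨w, hw⟩ := G.exists_isLeafOf (Finset.card_pos.1 (by omega : 0 < T.card))
    rw [M.marginal_factors_of_leaf hw hw.1]
    exact ih _ (by rw [Finset.card_erase_of_mem hw.1, hk]; rfl)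

theorem prob_empty (v : ∀ n, σ n) : M.prob ∅ v = 1 := by
  rw [← M.marginal_factors_self Finset.univ v]
  unfold prob marginal
  simp only [Finset.notMem_empty, Finset.mem_univ, not_true_eq_false, false_imp_iff,
    implies_true]
  rfl

theorem qValue_univ (v : ∀ n, σ n) : M.qValue V Finset.univ v = M.prob V v := by
  unfold prob qValue marginal
  refine Finset.sum_congr (Finset.filter_congr fun ω _ => ?_) fun ω _ => rfl
  simp

theorem qValue_erase_of_mem {w : N} (hw : G.IsLeafOf T w) (hwV : w ∈ V) (v : ∀ n, σ n) :
    M.qValue V (T.erase w) v = marginal {w} (M.qValue V T) v := by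
  have hd : Disjoint {w} (T \ V) := by simp [hwV]
  have h1 : ({w} ∪ T \ V).erase w = T.erase w \ V := by
    ext n
    by_cases h : n = w
    · simp [h, hwV]
    · simp [h]
  unfold qValue
  rw [← marginal_union hd, M.marginal_factors_of_leaf hw (by simp), h1]

theorem qValue_erase_of_notMem {w : N} (hw : G.IsLeafOf T w) (hwV : w ∉ V) (v : ∀ n, σ n) :
    M.qValue V (T.erase w) v = M.qValue V T v := by
  unfold qValue
  rw [M.marginal_factors_of_leaf (H := T \ V) hw (by simp [hw.1, hwV]), Finset.erase_sdiff_comm]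

theorem qValue_eq_mul_sdiff (hT : G.HiddenParentClosed V T)
    (hS : G.IsCClosed V T S) (v : ∀ n, σ n) :
    M.qValue V T v = M.qValue V S v * M.qValue V (T \ S) v := by
  have hd : Disjoint S (T \ S) := Finset.disjoint_sdiff
  -- The parameters of a union of components do not depend on hidden variables outside of it.
  have key : ∀ A B : Finset N, G.IsCClosed V T A → Disjoint A B →
      IndependentOf (B \ V) (M.factors A) := fun A B hA hAB => by
    refine M.independentOf_factors (hAB.mono_right Finset.sdiff_subset) fun n hn m hm hmB => ?_
    rw [Finset.mem_sdiff] at hmB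
    exact Finset.disjoint_left.1 hAB (hA.hiddenParentClosed hT m hmB.2 n hn hm) hmB.1
  have hH : T \ V = S \ V ∪ (T \ S) \ V := by
    rw [← Finset.union_sdiff_distrib, Finset.union_sdiff_of_subset hS.1]
  have hprod : M.factors T = fun ω => M.factors S ω * M.factors (T \ S) ω := by
    funext ω
    rw [factors, factors, factors, mul_comm, Finset.prod_sdiff hS.1]
  unfold qValue
  rw [hH, hprod, marginal_mul_mul (hd.mono Finset.sdiff_subset Finset.sdiff_subset)
    (key _ _ hS hd) (key _ _ hS.sdiff hd.symm)]

theorem qValue_nonneg (v : ∀ n, σ n) : 0 ≤ M.qValue V T v :=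
  Finset.sum_nonneg fun _ _ => Finset.prod_nonneg fun _ _ => M.nonneg _ _ _

end Model

namespace Expr

theorem eval_listProd_map_param (M : Model G σ) (l : List N) (v : ∀ n, σ n) :
    (listProd (l.map param) : Expr N σ).eval M v = (l.map fun n => M.factor n v).prod := by
  induction l with
  | nil => rfl
  | cons n l ih =>
    rw [List.map_cons, List.map_cons, List.prod_cons, ← ih]
    rfl

theorem isDefined_listProd_map_param (M : Model G σ) (l : List N) (v : ∀ n, σ n) :
    (listProd (l.map param) : Expr N σ).IsDefined M v := by
  induction l with
  | nil => trivial
  | cons n l ih => exact ⟨trivial, ih⟩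

theorem isDefined_cFactor (M : Model G σ) (V S : Finset N) (v : ∀ n, σ n) :
    (cFactor σ V S).IsDefined M v := fun _ _ =>
  ⟨isDefined_listProd_map_param .., isDefined_listProd_map_param ..⟩

theorem eval_cFactor (M : Model G σ) (V S : Finset N) (v : ∀ n, σ n) :
    (cFactor σ V S).eval M v = M.qValue V S v := by
  refine Finset.sum_congr rfl fun ω _ => ?_
  change eval M _ ω * eval M _ ω = _
  rw [eval_listProd_map_param, eval_listProd_map_param, Finset.prod_map_toList,
    Finset.prod_map_toList, Model.factors, ← Finset.prod_union
      (Finset.disjoint_sdiff_inter S V), Finset.sdiff_union_inter]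

theorem eval_sum (M : Model G σ) (W : Finset N) (e : Expr N σ) (v : ∀ n, σ n) :
    (sum W e).eval M v = marginal W (e.eval M) v := rfl

end Expr

/-! ### Identification of c-factors -/

/-- The c-factor `Q[S]` is positive under every model with positive observational distribution, and
some expression in the observed variables and without parameters is its projection. -/
def Identified (G : CausalGraph N) (σ : N → Type*) [∀ n, Fintype (σ n)]
    [∀ n, DecidableEq (σ n)] (V S : Finset N) : Prop :=
  ∃ e : Expr N σ, e.ParamFree ∧ e.mentions G ⊆ ↑V ∧
    ∀ M ∈ positiveModels G σ V, ∀ v,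
      e.IsDefined M v ∧ e.eval M v = M.qValue V S v ∧ 0 < M.qValue V S v

namespace Identified

variable {V T S : Finset N}

theorem univ (V : Finset N) : Identified G σ V Finset.univ := by
  refine ⟨.condProb V ∅, trivial, by simp [Expr.mentions], fun M hM v => ⟨?_, ?_, ?_⟩⟩
  · simp [Expr.IsDefined, M.prob_empty]
  · simp [Expr.eval, M.prob_empty, M.qValue_univ]
  · rw [M.qValue_univ]
    exact hM v

theorem empty (V : Finset N) : Identified G σ V ∅ := by
  have h : ∀ (M : Model G σ) v, M.qValue V ∅ v = 1 := fun M v => by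
    rw [Model.qValue, Finset.empty_sdiff, M.marginal_factors_self]
  exact ⟨.const 1, trivial, by simp [Expr.mentions], fun M _ v =>
    ⟨trivial, (h M v).symm, by rw [h]; exact one_pos⟩⟩

theorem erase (hT : Identified G σ V T) {w : N} (hw : G.IsLeafOf T w) :
    Identified G σ V (T.erase w) := by
  obtain ⟨e, hp, hm, he⟩ := hT
  by_cases hwV : w ∈ V
  · refine ⟨.sum {w} e, hp, ?_, fun M hM v => ⟨fun ω _ => (he M hM ω).1, ?_, ?_⟩⟩
    · simp [Expr.mentions, Set.insert_subset_iff, hwV, hm]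
    · rw [Expr.eval_sum, M.qValue_erase_of_mem hw hwV]
      exact Finset.sum_congr rfl fun ω _ => (he M hM ω).2.1
    · rw [M.qValue_erase_of_mem hw hwV]
      exact Finset.sum_pos (fun ω _ => (he M hM ω).2.2) ⟨v, by simp⟩
  · refine ⟨e, hp, hm, fun M hM v => ?_⟩
    rw [M.qValue_erase_of_notMem hw hwV]
    exact he M hM v

/-- If `Q[T]` is identified, then so is `Q[S]` for every union `S` of maximal c-components of
`T`. -/
theorem of_isCClosed (hT : Identified G σ V T) (hc : G.HiddenParentClosed V T)
    (hS : G.IsCClosed V T S) : Identified G σ V S := by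
  induction hk : T.card generalizing T S with
  | zero =>
    rw [Finset.card_eq_zero] at hk
    rw [show S = ∅ from Finset.subset_empty.1 (hk ▸ hS.1)]
    exact empty V
  | succ k ih =>
    obtain ⟨w, hw⟩ := G.exists_isLeafOf (Finset.card_pos.1 (by omega : 0 < T.card))
    have hrec : Identified G σ V (S.erase w) :=
      ih (hT.erase hw) (hc.erase hw) (hS.erase w)
        (by rw [Finset.card_erase_of_mem hw.1, hk]; rfl)
    by_cases hwS : w ∈ S
    · obtain ⟨e₁, hp₁, hm₁, he₁⟩ := hrec
      obtain ⟨e₂, hp₂, hm₂, he₂⟩ := hT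
      obtain ⟨e₃, hp₃, hm₃, he₃⟩ := Identified.erase ⟨e₂, hp₂, hm₂, he₂⟩ hw
      refine ⟨.mul e₁ (.div e₂ e₃), ⟨hp₁, hp₂, hp₃⟩,
        Set.union_subset hm₁ (Set.union_subset hm₂ hm₃), fun M hM v => ?_⟩
      obtain ⟨d₁, v₁, p₁⟩ := he₁ M hM v
      obtain ⟨d₂, v₂, p₂⟩ := he₂ M hM v
      obtain ⟨d₃, v₃, p₃⟩ := he₃ M hM v
      have f₂ := M.qValue_eq_mul_sdiff hc hS v
      have f₃ := M.qValue_eq_mul_sdiff (hc.erase hw) (hS.erase w) v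
      have hsd : T.erase w \ S.erase w = T \ S := by
        ext n
        by_cases h : n = w
        · simp [h, hwS]
        · simp [h]
      rw [hsd] at f₃
      refine ⟨⟨d₁, d₂, d₃, by rw [v₃]; exact p₃.ne'⟩, ?_, ?_⟩
      · change e₁.eval M v * (e₂.eval M v / e₃.eval M v) = _
        rw [v₁, v₂, v₃, mul_div_assoc', div_eq_iff p₃.ne', f₂, f₃]
        ring
      · rw [f₂] at p₂
        exact pos_of_mul_pos_left p₂ (M.qValue_nonneg v)
    · rwa [Finset.erase_eq_of_notMem hwS] at hrec

end Identified

theorem CausalGraph.VComputable.identified {V S : Finset N} (hS : G.VComputable V S) :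
    Identified G σ V S ∧ G.HiddenParentClosed V S := by
  induction hS with
  | whole => exact ⟨.univ V, fun u _ _ _ _ => Finset.mem_univ u⟩
  | component _ hC ih =>
    exact ⟨ih.1.of_isCClosed ih.2 hC.isCClosed, hC.isCClosed.hiddenParentClosed ih.2⟩
  | prune _ hw ih => exact ⟨ih.1.erase hw, ih.2.erase hw⟩

end Semantics

end CausalID

theorem mainTheorem2 {N : Type*} [Fintype N] [DecidableEq N] {σ : N → Type*}
    [∀ n, Fintype (σ n)] [∀ n, DecidableEq (σ n)]
    (G : CausalID.CausalGraph N) (V : Finset N) (hG : G.SemiMarkovian V)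
    (S : Finset N) (hS : G.VComputable V S) :
    ∃ e : CausalID.Expr N σ,
      CausalID.Expr.IsProjection G V (CausalID.positiveModels G σ V) e
        (CausalID.Expr.cFactor σ V S) := by
  obtain ⟨⟨e, hp, hm, he⟩, -⟩ := hS.identified (σ := σ)
  refine ⟨e, fun M hM v => ⟨(he M hM v).1, CausalID.Expr.isDefined_cFactor M V S v, ?_⟩, hp, hm⟩
  rw [(he M hM v).2.1, CausalID.Expr.eval_cFactor]
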